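/- Let $(\Omega,\mathcal F,P)$ be an atomless probability space (for instance an atomless standard probability space), let $N\ge 1$, and let $U:\mathbb R^N\to\mathbb R$ be nondecreasing for the componentwise order, differentiable and strictly concave, with $\sup_{\mathbf y\in\mathbb R^N}U(\mathbf y)>0$. Suppose that for some $y\in\mathbb R$ the supremum $\sup\{U(\mathbf x)\mid \mathbf x\in\mathbb R^N,\ \sum_{i=1}^N x^i=y\}$ is attained. For $\mathbf X\in(L^\infty(\Omega,\mathcal F,P))^N$ put $$\rho(\mathbf X):=\inf\Big\{\sum_{i=1}^N Y^i \;\Big|\; \mathbf Y\in (L^\infty)^N,\ \sum_{i=1}^N Y^i\in\mathbb R,\ \mathbb E[U(\mathbf X+\mathbf Y)]\ge 0\Big\},$$ where $\sum_{i=1}^N Y^i\in\mathbb R$ means that the sum is almost surely equal to a constant. Then $\rho$ is finite valued, $\rho(\mathbf X)$ depends only on the law of $\mathbf X$ under $P$, and every probability measure $Q$ on $\mathbb R^N$ with bounded support is the law of some $\mathbf Z\in(L^\infty)^N$; write $\rho(Q):=\rho(\mathbf Z)$ for any such $\mathbf Z$. Moreover: 1. If $r>0$ and $Q_n$ ($n\in\mathbb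 N$) and $Q_\infty$ are probability measures on $\mathbb R^N$ with $Q_n(B_r)=1$ for all $n$ and $Q_\infty(B_r)=1$, where $B_r$ is the closed Euclidean ball of radius $r$ centred at the origin, and if $Q_n\to Q_\infty$ weakly, then $\lim_{n\to\infty}\rho(Q_n)=\rho(Q_\infty)$. 2. Consequently, if $\mathbf X\in(L^\infty)^N$ and $\mathbf X_1,\mathbf X_2,\dots$ are i.i.d. random vectors on $(\Omega,\mathcal F,P)$ with the law of $\mathbf X$, then the empirical measures $\widehat P_n=\frac1n\sum_{i=1}^n\delta_{\mathbf X_i}$ satisfy $\lim_{n\to\infty}\rho(\widehat P_n)=\rho(\mathbf X)$ $P$-almost surely. -/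

import Mathlib

open MeasureTheory ProbabilityTheory Filter Topology
open scoped ENNReal

namespace SystemicRisk

/-- `P` is atomless: every measurable set of positive measure contains a measurable subset of
strictly smaller positive measure. -/
def IsAtomless {Ω : Type*} [MeasurableSpace Ω] (P : Measure Ω) : Prop :=
  ∀ A : Set Ω, MeasurableSet A → 0 < P A →
    ∃ B : Set Ω, B ⊆ A ∧ MeasurableSet B ∧ 0 < P B ∧ P B < P A

/-- The aggregation map `π(x) = x¹ + ⋯ + x^N`. -/
def total {N : ℕ} (x : EuclideanSpace ℝ (Fin N)) : ℝ := ∑ i, x i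

/-- The sup-convolution `(□_π U)(y) = sup {U(x) | π(x) = y}`, with values in `[-∞, ∞]`. -/
noncomputable def supConv {N : ℕ} (U : EuclideanSpace ℝ (Fin N) → ℝ) (y : ℝ) : EReal :=
  sSup {a : EReal | ∃ x : EuclideanSpace ℝ (Fin N), total x = y ∧ a = (U x : EReal)}

/-- The standing assumptions on the multivariate utility function: it is nondecreasing for the
componentwise order, differentiable, strictly concave, has positive supremum, and the supremum
defining `□_π U` is attained at some level `y`. -/
structure IsUtility {N : ℕ} (U : EuclideanSpace ℝ (Fin N) → ℝ) : Prop where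
  nondecreasing : ∀ x y : EuclideanSpace ℝ (Fin N), (∀ i, x i ≤ y i) → U x ≤ U y
  differentiable : Differentiable ℝ U
  strictConcave : StrictConcaveOn ℝ Set.univ U
  sup_pos : 0 < ⨆ y, (U y : EReal)
  exists_optimum : ∃ y : ℝ, ∃ x : EuclideanSpace ℝ (Fin N),
    total x = y ∧ supConv U y = (U x : EReal)

/-- The shortfall systemic risk measure
`ρ(X) = inf {∑ Yⁱ | Y ∈ (L^∞)^N, ∑ Yⁱ ∈ ℝ, E[U(X + Y)] ≥ 0}`, where `inf ∅ = +∞`.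
An element of `(L^∞)^N` is represented by a vector valued function `Y` with `MemLp Y ∞ P`, and
`∑ Yⁱ ∈ ℝ` says that the sum is almost surely equal to a constant `c`. -/
noncomputable def rho {Ω : Type*} [MeasurableSpace Ω] (P : Measure Ω) {N : ℕ}
    (U : EuclideanSpace ℝ (Fin N) → ℝ) (X : Ω → EuclideanSpace ℝ (Fin N)) : EReal :=
  sInf {a : EReal | ∃ (Y : Ω → EuclideanSpace ℝ (Fin N)) (c : ℝ), MemLp Y ∞ P ∧
    (∀ᵐ ω ∂P, total (Y ω) = c) ∧ 0 ≤ ∫ ω, U (X ω + Y ω) ∂P ∧ a = (c : EReal)}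

/-- `ρ` as a function of laws: the value `ρ(Z)` for `Z ∈ (L^∞)^N` with law `Q` under `P`.
The infimum over all such `Z` selects this common value. -/
noncomputable def rhoLaw {Ω : Type*} [MeasurableSpace Ω] (P : Measure Ω) {N : ℕ}
    (U : EuclideanSpace ℝ (Fin N) → ℝ) (Q : Measure (EuclideanSpace ℝ (Fin N))) : EReal :=
  sInf {a : EReal | ∃ Z : Ω → EuclideanSpace ℝ (Fin N),
    MemLp Z ∞ P ∧ P.map Z = Q ∧ a = rho P U Z}

/-- The empirical measure `(1/n) ∑_{i<n} δ_{x i}` of the first `n` points of a sequence. -/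
noncomputable def empiricalMeasure {N : ℕ} (x : ℕ → EuclideanSpace ℝ (Fin N)) (n : ℕ) :
    Measure (EuclideanSpace ℝ (Fin N)) :=
  (n : ℝ≥0∞)⁻¹ • ∑ i ∈ Finset.range n, Measure.dirac (x i)

end SystemicRisk

/-! Everything rests on one estimate (`exists_finset_rho_le_add`): if `X` and `X'` take values in
the same ball and finitely many test functions have nearly equal expectations under both, then
`ρ(X') ≤ ρ(X) + ε`, the test functions and the tolerance depending only on `U`, `r` and `ε`.
Exchanging `X` and `X'` gives continuity, and equal laws give law invariance.

To prove it, take `Y` admissible for `X` and a partition of unity `φ i` with small supports. By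
Jensen, `Y` may be replaced near each centre by its `φ i (X)`-weighted mean `y i`, and then `∑ φ i
(X') • y i` is nearly admissible for `X'` (`exists_transfer`). No bound on the `y i` is needed:
attainment of the supremum supplies a Lagrange multiplier, so `U` lies below an affine function of
the coordinate sum (`exists_affine_bound`) and is bounded above on every slice of fixed total. Mass
mismatched between the two laws therefore has bounded cost. The small deficit is repaired by mixing
in a constant allocation of uniformly positive utility.

Laws are realized on `Ω` through a uniform variable built from a maximal chain of measurable sets.
The empirical statement follows from the strong law for a countable family of test functions. -/

open scoped BoundedContinuousFunction

namespace SystemicRisk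

/-! ### Coordinate sums and constant shifts -/

section Total

variable {N : ℕ}

/-- The vector all of whose coordinates equal `s`. -/
noncomputable def constVec (N : ℕ) (s : ℝ) : EuclideanSpace ℝ (Fin N) :=
  WithLp.toLp 2 fun _ => s

@[simp]
lemma constVec_apply (s : ℝ) (i : Fin N) : constVec N s i = s := rfl

lemma total_add (x y : EuclideanSpace ℝ (Fin N)) : total (x + y) = total x + total y := by
  simp [total, Finset.sum_add_distrib]

lemma total_sub (x y : EuclideanSpace ℝ (Fin N)) : total (x - y) = total x - total y := by
  simp [total, Finset.sum_sub_distrib]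

lemma total_smul (a : ℝ) (x : EuclideanSpace ℝ (Fin N)) : total (a • x) = a * total x := by
  simp [total, Finset.mul_sum]

@[simp]
lemma total_constVec (s : ℝ) : total (constVec N s) = N * s := by
  simp [total]

/-- `total` as a continuous linear map. -/
noncomputable def totalCLM (N : ℕ) : EuclideanSpace ℝ (Fin N) →L[ℝ] ℝ :=
  LinearMap.toContinuousLinearMap
    { toFun := total, map_add' := total_add, map_smul' := total_smul }

@[simp]
lemma totalCLM_apply (x : EuclideanSpace ℝ (Fin N)) : totalCLM N x = total x := rfl

lemma total_sum {ι : Type*} (s : Finset ι) (f : ι → EuclideanSpace ℝ (Fin N)) :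
    total (∑ i ∈ s, f i) = ∑ i ∈ s, total (f i) :=
  map_sum (totalCLM N) f s

lemma abs_apply_le_norm (x : EuclideanSpace ℝ (Fin N)) (i : Fin N) : |x i| ≤ ‖x‖ := by
  simpa using PiLp.norm_apply_le x i

lemma total_le_of_norm_le {x : EuclideanSpace ℝ (Fin N)} {r : ℝ} (hx : ‖x‖ ≤ r) :
    total x ≤ N * r := by
  have : total x ≤ ∑ _i : Fin N, r :=
    Finset.sum_le_sum fun i _ => (le_abs_self _).trans ((abs_apply_le_norm x i).trans hx)
  simpa using this

end Total

/-- Concave differentiable functions lie below their tangents. -/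
lemma _root_.ConcaveOn.le_add_fderiv {E : Type*} [NormedAddCommGroup E] [NormedSpace ℝ E]
    {f : E → ℝ} (hf : ConcaveOn ℝ Set.univ f) {w : E} (hd : DifferentiableAt ℝ f w) (z : E) :
    f z ≤ f w + fderiv ℝ f w (z - w) := by
  have h1 : HasDerivAt (fun t : ℝ => f (w + t • (z - w))) (fderiv ℝ f w (z - w)) 0 := by
    have hl : HasDerivAt (fun t : ℝ => w + t • (z - w)) (z - w) 0 := by
      simpa using ((hasDerivAt_id (0 : ℝ)).smul_const (z - w)).const_add w
    have hd' : HasFDerivAt f (fderiv ℝ f w) (w + (0 : ℝ) • (z - w)) := by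
      simpa using hd.hasFDerivAt
    exact hd'.comp_hasDerivAt 0 hl
  have h2 := h1.tendsto_slope_zero_right
  have h3 : ∀ᶠ t : ℝ in 𝓝[>] 0,
      f z - f w ≤ t⁻¹ • (f (w + (0 + t) • (z - w)) - f (w + (0 : ℝ) • (z - w))) := by
    filter_upwards [Ioo_mem_nhdsGT (zero_lt_one' ℝ)] with t ht
    have h := hf.2 (Set.mem_univ w) (Set.mem_univ z) (sub_nonneg.2 ht.2.le) ht.1.le (by ring)
    have e : (1 - t) • w + t • z = w + t • (z - w) := by
      rw [smul_sub, sub_smul, one_smul]; abel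
    rw [e] at h
    simp only [smul_eq_mul] at h
    simp only [zero_add, zero_smul, add_zero, smul_eq_mul]
    rw [inv_mul_eq_div, le_div_iff₀ ht.1]
    linarith
  linarith [ge_of_tendsto h2 h3]

/-! ### Affine upper bound and positivity of the utility -/

namespace IsUtility

variable {N : ℕ} {U : EuclideanSpace ℝ (Fin N) → ℝ}

lemma continuous (hU : IsUtility U) : Continuous U := hU.differentiable.continuous

lemma concaveOn (hU : IsUtility U) : ConcaveOn ℝ Set.univ U := hU.strictConcave.concaveOn

/-- Monotonicity places the midpoint of the segment at or below its upper end; strict concavity then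
forbids equality of the end values. -/
lemma lt_add_constVec (hU : IsUtility U) (hN : 1 ≤ N) (x : EuclideanSpace ℝ (Fin N)) {s : ℝ}
    (hs : 0 < s) : U x < U (x + constVec N s) := by
  have hne : x ≠ x + constVec N s := by
    intro h
    have := congrArg (fun v : EuclideanSpace ℝ (Fin N) => v ⟨0, hN⟩) h
    simp at this
    exact hs.ne' this
  have hhalf := hU.strictConcave.2 (Set.mem_univ x) (Set.mem_univ (x + constVec N s)) hne
    (by norm_num : (0 : ℝ) < 1 / 2) (by norm_num : (0 : ℝ) < 1 / 2) (by norm_num)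
  have hmid : U ((1 / 2 : ℝ) • x + (1 / 2 : ℝ) • (x + constVec N s)) ≤ U (x + constVec N s) := by
    refine hU.nondecreasing _ _ fun i => ?_
    simp
    linarith
  simp only [smul_eq_mul] at hhalf
  linarith

/-- Lagrange multipliers: at a maximizer on the slice the derivative kills every direction of total
zero, hence is a multiple of `total`, and the tangent there is the bound. The slope is positive
because `U` strictly increases along the diagonal. -/
lemma exists_affine_bound (hU : IsUtility U) (hN : 1 ≤ N) :
    ∃ A l : ℝ, 0 < l ∧ ∀ x, U x ≤ A + l * total x := by
  obtain ⟨y, x₀, hx₀, hmax⟩ := hU.exists_optimum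
  have hle : ∀ x, total x = y → U x ≤ U x₀ := by
    intro x hx
    have : (U x : EReal) ≤ supConv U y := le_sSup ⟨x, hx, rfl⟩
    rw [hmax] at this
    exact_mod_cast this
  have hN' : (N : ℝ) ≠ 0 := by positivity
  set D := fderiv ℝ U x₀ with hD
  have hker : ∀ v, total v = 0 → D v = 0 := by
    intro v hv
    have hl : HasDerivAt (fun t : ℝ => x₀ + t • v) v 0 := by
      simpa using ((hasDerivAt_id (0 : ℝ)).smul_const v).const_add x₀
    have hd' : HasFDerivAt U D (x₀ + (0 : ℝ) • v) := by
      simpa using (hU.differentiable x₀).hasFDerivAt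
    refine IsLocalMax.hasDerivAt_eq_zero ?_ (hd'.comp_hasDerivAt 0 hl)
    refine Filter.Eventually.of_forall fun t => ?_
    simpa using hle (x₀ + t • v) (by simp [total_add, total_smul, hx₀, hv])
  have hDv : ∀ v, D v = D (constVec N 1) / N * total v := by
    intro v
    have h0 := hker (v - (total v / N) • constVec N 1) (by
      rw [total_sub, total_smul, total_constVec]; field_simp; ring)
    rw [map_sub, map_smul, sub_eq_zero] at h0
    rw [h0, smul_eq_mul]
    ring
  have htan : ∀ x, U x ≤ U x₀ + D (x - x₀) := fun x =>
    hU.concaveOn.le_add_fderiv (hU.differentiable x₀) x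
  refine ⟨U x₀ - D (constVec N 1) / N * y, D (constVec N 1) / N, ?_, fun x => ?_⟩
  · have h1 := htan (x₀ + constVec N 1)
    rw [add_sub_cancel_left] at h1
    have h2 := hU.lt_add_constVec hN x₀ one_pos
    have : 0 < D (constVec N 1) := by linarith
    positivity
  · have h1 := htan x
    rw [hDv, total_sub, hx₀] at h1
    linarith

lemma exists_pos (hU : IsUtility U) : ∃ x, 0 < U x := by
  obtain ⟨x, hx⟩ := lt_iSup_iff.1 hU.sup_pos
  exact ⟨x, by exact_mod_cast hx⟩

lemma exists_uniform_pos (hU : IsUtility U) (r : ℝ) :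
    ∃ (y : EuclideanSpace ℝ (Fin N)) (a : ℝ), 0 < a ∧ ∀ x, ‖x‖ ≤ r → a ≤ U (x + y) := by
  obtain ⟨x₀, hx₀⟩ := hU.exists_pos
  refine ⟨x₀ + constVec N r, U x₀, hx₀, fun x hx => hU.nondecreasing _ _ fun i => ?_⟩
  have := (abs_le.1 ((abs_apply_le_norm x i).trans hx)).1
  simp
  linarith

end IsUtility

/-! ### Continuous functions of bounded random vectors -/

section Integrability

variable {Ω : Type*} [MeasurableSpace Ω] {P : Measure Ω}

lemma exists_ae_norm_le {E : Type*} [NormedAddCommGroup E] {W : Ω → E} (hW : MemLp W ∞ P) :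
    ∃ r : ℝ, 0 < r ∧ ∀ᵐ ω ∂P, ‖W ω‖ ≤ r := by
  have h := hW.2
  rw [eLpNorm_exponent_top] at h
  refine ⟨(eLpNormEssSup W P).toReal + 1, by positivity, ?_⟩
  filter_upwards [enorm_ae_le_eLpNormEssSup W P] with ω hω
  have := ENNReal.toReal_mono h.ne hω
  rw [toReal_enorm] at this
  linarith

lemma _root_.MeasureTheory.MemLp.continuous_comp {E F : Type*} [NormedAddCommGroup E]
    [ProperSpace E] [NormedAddCommGroup F] {W : Ω → E} (hW : MemLp W ∞ P) {g : E → F}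
    (hg : Continuous g) : MemLp (fun ω => g (W ω)) ∞ P := by
  obtain ⟨r, -, hr⟩ := exists_ae_norm_le hW
  obtain ⟨C, hC⟩ := (isCompact_closedBall (0 : E) r).exists_bound_of_continuousOn hg.continuousOn
  refine memLp_top_of_bound (hg.comp_aestronglyMeasurable hW.1) C ?_
  filter_upwards [hr] with ω hω
  exact hC _ (by simpa using hω)

lemma integrable_continuous_comp [IsFiniteMeasure P] {E F : Type*} [NormedAddCommGroup E]
    [ProperSpace E] [NormedAddCommGroup F] {W : Ω → E} (hW : MemLp W ∞ P) {g : E → F}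
    (hg : Continuous g) : Integrable (fun ω => g (W ω)) P :=
  (hW.continuous_comp hg).integrable le_top

end Integrability

/-! ### Finiteness of the risk measure -/

section Finite

variable {Ω : Type*} [MeasurableSpace Ω] {P : Measure Ω} {N : ℕ}
  {U : EuclideanSpace ℝ (Fin N) → ℝ}

lemma rho_le {X Y : Ω → EuclideanSpace ℝ (Fin N)} {c : ℝ} (hY : MemLp Y ∞ P)
    (hc : ∀ᵐ ω ∂P, total (Y ω) = c) (h : 0 ≤ ∫ ω, U (X ω + Y ω) ∂P) :
    rho P U X ≤ c :=
  sInf_le ⟨Y, c, hY, hc, h, rfl⟩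

variable [IsProbabilityMeasure P]

lemma rho_le_total {X : Ω → EuclideanSpace ℝ (Fin N)} {r a : ℝ} (hr : ∀ᵐ ω ∂P, ‖X ω‖ ≤ r)
    {y : EuclideanSpace ℝ (Fin N)} (ha : 0 < a) (hy : ∀ x, ‖x‖ ≤ r → a ≤ U (x + y)) :
    rho P U X ≤ total y := by
  refine rho_le (Y := fun _ => y) (memLp_const y) (ae_of_all _ fun _ => rfl) ?_
  refine integral_nonneg_of_ae ?_
  filter_upwards [hr] with ω hω
  exact ha.le.trans (hy _ hω)

/-- Integrating the affine bound leaves only the total of `Y`, so the lower bound does not see the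
size of its components. -/
lemma le_of_admissible (hU : IsUtility U) {A l : ℝ} (hl : 0 < l)
    (hA : ∀ x, U x ≤ A + l * total x) {r : ℝ} {X Y : Ω → EuclideanSpace ℝ (Fin N)} {c : ℝ}
    (hX : MemLp X ∞ P) (hr : ∀ᵐ ω ∂P, ‖X ω‖ ≤ r) (hY : MemLp Y ∞ P)
    (hc : ∀ᵐ ω ∂P, total (Y ω) = c) (h : 0 ≤ ∫ ω, U (X ω + Y ω) ∂P) :
    -(A / l) - N * r ≤ c := by
  have h1 : ∫ ω, U (X ω + Y ω) ∂P ≤ ∫ _ω, A + l * (N * r + c) ∂P := by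
    refine integral_mono_ae (integrable_continuous_comp (hX.add hY) hU.continuous)
      (integrable_const _) ?_
    filter_upwards [hr, hc] with ω h1 h2
    refine (hA _).trans ?_
    have := total_le_of_norm_le h1
    rw [total_add, h2]
    gcongr
  rw [integral_const, probReal_univ, one_smul] at h1
  have : 0 ≤ A / l + (N * r + c) := by
    have := div_nonneg (h.trans h1) hl.le
    rwa [add_div, mul_div_cancel_left₀ _ hl.ne'] at this
  linarith

lemma exists_rho_eq_coe (hU : IsUtility U) (hN : 1 ≤ N) {X : Ω → EuclideanSpace ℝ (Fin N)}
    (hX : MemLp X ∞ P) : ∃ a : ℝ, rho P U X = a := by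
  obtain ⟨r, -, hr⟩ := exists_ae_norm_le hX
  obtain ⟨y, a, ha, hy⟩ := hU.exists_uniform_pos r
  obtain ⟨A, l, hl, hA⟩ := hU.exists_affine_bound hN
  have h1 := rho_le_total hr ha hy
  have h2 : ((-(A / l) - N * r : ℝ) : EReal) ≤ rho P U X := by
    refine le_sInf ?_
    rintro _ ⟨Y, c, hY, hc, h, rfl⟩
    exact_mod_cast le_of_admissible hU hl hA hX hr hY hc h
  refine ⟨(rho P U X).toReal, (EReal.coe_toReal ?_ ?_).symm⟩
  · exact ne_top_of_le_ne_top (EReal.coe_ne_top _) h1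
  · exact ne_bot_of_le_ne_bot (EReal.coe_ne_bot _) h2

end Finite

/-! ### Moving an allocation from one random vector to another -/

section Transfer

variable {Ω : Type*} [MeasurableSpace Ω] {P : Measure Ω} [IsProbabilityMeasure P] {N : ℕ}
  {U : EuclideanSpace ℝ (Fin N) → ℝ}

/-- Jensen's inequality for the weighted average of `Y` with weight `φ`. -/
lemma exists_weighted_jensen (hU : IsUtility U) {φ : Ω → ℝ} (hφ : MemLp φ ∞ P)
    (hφ0 : ∀ ω, 0 ≤ φ ω) {X Y : Ω → EuclideanSpace ℝ (Fin N)} (hX : MemLp X ∞ P)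
    (hY : MemLp Y ∞ P) {c : ℝ} (hc : ∀ᵐ ω ∂P, total (Y ω) = c) (hN : 1 ≤ N)
    {p : EuclideanSpace ℝ (Fin N)} (hp : ∀ᵐ ω ∂P, φ ω ≠ 0 → ∀ j, X ω j ≤ p j) :
    ∃ y : EuclideanSpace ℝ (Fin N), total y = c ∧
      ∫ ω, φ ω * U (X ω + Y ω) ∂P ≤ (∫ ω, φ ω ∂P) * U (p + y) := by
  have hφi : Integrable φ P := hφ.integrable le_top
  -- With zero weight both sides vanish, so any vector of total `c` serves.
  rcases eq_or_ne (∫ ω, φ ω ∂P) 0 with h0 | h0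
  · have hae := (integral_eq_zero_iff_of_nonneg hφ0 hφi).1 h0
    refine ⟨constVec N (c / N), ?_, ?_⟩
    · rw [total_constVec]
      field_simp
    · rw [h0, zero_mul]
      refine (integral_eq_zero_of_ae ?_).le
      filter_upwards [hae] with ω hω
      simp [hω]
  · have hφY : Integrable (fun ω => φ ω • Y ω) P := by
      exact (hφi.smul_of_top_left hY)
    set q := ∫ ω, φ ω ∂P with hq
    set y : EuclideanSpace ℝ (Fin N) := q⁻¹ • ∫ ω, φ ω • Y ω ∂P with hy
    have hqy : q • y = ∫ ω, φ ω • Y ω ∂P := by rw [hy, smul_inv_smul₀ h0]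
    refine ⟨y, ?_, ?_⟩
    · have : total (∫ ω, φ ω • Y ω ∂P) = q * c := by
        rw [← totalCLM_apply, ← ContinuousLinearMap.integral_comp_comm _ hφY]
        rw [hq, ← integral_mul_const]
        refine integral_congr_ae ?_
        filter_upwards [hc] with ω hω
        simp [hω]
      rw [hy, total_smul, this, inv_mul_cancel_left₀ h0]
    -- Jensen via the tangent at `p + y`: `y` is the weighted mean of `Y`, so the linear term
    -- integrates to zero.
    · set D := fderiv ℝ U (p + y) with hD
      have hXY := integrable_continuous_comp (hX.add hY) hU.continuous
      have hXYm := (hX.add hY).continuous_comp hU.continuous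
      have hsub : Integrable (fun ω => φ ω • (Y ω - y)) P := by
        simp_rw [smul_sub]
        exact hφY.sub (hφi.smul_const y)
      have hint : ∫ ω, φ ω • (Y ω - y) ∂P = 0 := by
        simp_rw [smul_sub]
        rw [integral_sub hφY (hφi.smul_const y), integral_smul_const, ← hq, hqy, sub_self]
      calc ∫ ω, φ ω * U (X ω + Y ω) ∂P
          ≤ ∫ ω, φ ω * U (p + y) + D (φ ω • (Y ω - y)) ∂P := by
            refine integral_mono_ae (hφi.smul_of_top_left hXYm)
              ((hφi.mul_const _).add (D.integrable_comp hsub)) ?_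
            filter_upwards [hp] with ω hω
            rcases eq_or_ne (φ ω) 0 with hz | hz
            · simp [hz]
            · have h1 : U (X ω + Y ω) ≤ U (p + Y ω) :=
                hU.nondecreasing _ _ fun j => by simpa using hω hz j
              have h2 := hU.concaveOn.le_add_fderiv (hU.differentiable (p + y)) (p + Y ω)
              rw [add_sub_add_left_eq_sub] at h2
              simp only [map_smul, smul_eq_mul]
              rw [← mul_add]
              exact mul_le_mul_of_nonneg_left (h1.trans h2) (hφ0 ω)
        _ = q * U (p + y) := by
            rw [integral_add (hφi.mul_const _) (D.integrable_comp hsub), integral_mul_const,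
              ContinuousLinearMap.integral_comp_comm D hsub, hint, map_zero, add_zero]

/-- Transport of an admissible allocation from `X` to `X'` along a partition of unity. -/
lemma exists_transfer (hU : IsUtility U) (hN : 1 ≤ N) {ι : Type*} [Fintype ι]
    (φ : ι → EuclideanSpace ℝ (Fin N) →ᵇ ℝ) (p : ι → EuclideanSpace ℝ (Fin N)) {r δ : ℝ}
    (hφ0 : ∀ i x, 0 ≤ φ i x) (hφ1 : ∀ x, ‖x‖ ≤ r → ∑ i, φ i x = 1)
    (hp : ∀ i x, φ i x ≠ 0 → ∀ j, |x j - p i j| ≤ δ)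
    {X X' Y : Ω → EuclideanSpace ℝ (Fin N)} {c : ℝ}
    (hX : MemLp X ∞ P) (hX' : MemLp X' ∞ P)
    (hrX : ∀ᵐ ω ∂P, ‖X ω‖ ≤ r) (hrX' : ∀ᵐ ω ∂P, ‖X' ω‖ ≤ r)
    (hY : MemLp Y ∞ P) (hc : ∀ᵐ ω ∂P, total (Y ω) = c)
    {M : ℝ} (hM : ∀ i y, total y = c → U (p i + constVec N δ + y) ≤ M)
    {y₀ : EuclideanSpace ℝ (Fin N)} (hy₀ : total y₀ = c)
    (hM₀ : ∀ i, -M ≤ U (p i + constVec N δ + y₀)) :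
    ∃ Y' : Ω → EuclideanSpace ℝ (Fin N), MemLp Y' ∞ P ∧
      (∀ᵐ ω ∂P, total (Y' ω) = c + N * (2 * δ)) ∧
      ∫ ω, U (X ω + Y ω) ∂P - M * ∑ i, |∫ ω, φ i (X ω) ∂P - ∫ ω, φ i (X' ω) ∂P| ≤
        ∫ ω, U (X' ω + Y' ω) ∂P := by
  set q : ι → ℝ := fun i => ∫ ω, φ i (X ω) ∂P with hq
  set q' : ι → ℝ := fun i => ∫ ω, φ i (X' ω) ∂P with hq'
  have hq0 : ∀ i, 0 ≤ q i := fun i => integral_nonneg fun ω => hφ0 i _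
  have hq0' : ∀ i, 0 ≤ q' i := fun i => integral_nonneg fun ω => hφ0 i _
  have hφX : ∀ i, MemLp (fun ω => φ i (X ω)) ∞ P := fun i => hX.continuous_comp (φ i).continuous
  have hφX' : ∀ i, MemLp (fun ω => φ i (X' ω)) ∞ P := fun i =>
    hX'.continuous_comp (φ i).continuous
  have hjen (i : ι) := exists_weighted_jensen hU (hφX i) (fun ω => hφ0 i _) hX hY hc hN
    (p := p i + constVec N δ) (ae_of_all _ fun ω hω j => by
      have := (abs_le.1 (hp i _ hω j)).2
      simp only [PiLp.add_apply, constVec_apply]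
      linarith)
  choose y hyc hyU using hjen
  -- The fraction of the mass `q' i` that is matched by `q i`; the unmatched rest receives the
  -- fallback `y₀`. If `q' i = 0`, division gives `θ i = 0` and `hqθ` still holds because `q i ≥ 0`.
  set θ : ι → ℝ := fun i => min (q i) (q' i) / q' i with hθ
  have hθ0 : ∀ i, 0 ≤ θ i := fun i => div_nonneg (le_min (hq0 i) (hq0' i)) (hq0' i)
  have hθ1 : ∀ i, θ i ≤ 1 := fun i => div_le_one_of_le₀ (min_le_right _ _) (hq0' i)
  have hqθ : ∀ i, q' i * θ i = min (q i) (q' i) := by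
    intro i
    rcases eq_or_ne (q' i) 0 with h | h
    · simp [h, hq0 i]
    · rw [hθ, mul_div_cancel₀ _ h]
  set z : ι → EuclideanSpace ℝ (Fin N) := fun i => θ i • y i + (1 - θ i) • y₀ with hz
  have hzc : ∀ i, total (z i) = c := fun i => by
    rw [hz, total_add, total_smul, total_smul, hyc, hy₀]; ring
  -- Where `φ i` is nonzero, `X'` is at least `p i - δ` in each coordinate, so the shift by `2 * δ`
  -- lifts it above `p i + δ`, the point produced by Jensen.
  set G : EuclideanSpace ℝ (Fin N) → EuclideanSpace ℝ (Fin N) :=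
    fun x => ∑ i, φ i x • z i + constVec N (2 * δ) with hG
  have hGc : Continuous G := by
    refine (continuous_finsetSum _ fun i _ => ?_).add continuous_const
    exact (φ i).continuous.smul continuous_const
  refine ⟨fun ω => G (X' ω), hX'.continuous_comp hGc, ?_, ?_⟩
  · filter_upwards [hrX'] with ω hω
    rw [hG, total_add, total_sum, total_constVec]
    simp_rw [total_smul, hzc]
    rw [← Finset.sum_mul, hφ1 _ hω, one_mul]
  set u : ι → ℝ := fun i => U (p i + constVec N δ + z i) with hu
  have hlower : ∑ i, q' i * u i ≤ ∫ ω, U (X' ω + G (X' ω)) ∂P := by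
    have hi : ∀ i, Integrable (fun ω => φ i (X' ω) * u i) P := fun i =>
      ((hφX' i).integrable le_top).mul_const _
    calc ∑ i, q' i * u i = ∫ ω, ∑ i, φ i (X' ω) * u i ∂P := by
          rw [integral_finsetSum _ fun i _ => hi i]
          simp_rw [integral_mul_const]
          rfl
      _ ≤ _ := by
          refine integral_mono_ae (integrable_finsetSum _ fun i _ => hi i)
            (integrable_continuous_comp (hX'.add (hX'.continuous_comp hGc)) hU.continuous) ?_
          filter_upwards [hrX'] with ω hω
          have h1 := hU.concaveOn.le_map_sum (t := Finset.univ) (w := fun i => φ i (X' ω))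
            (p := fun i => X' ω + constVec N (2 * δ) + z i) (fun i _ => hφ0 i _) (hφ1 _ hω)
            (fun i _ => Set.mem_univ _)
          have h2 : ∑ i, φ i (X' ω) • (X' ω + constVec N (2 * δ) + z i) = X' ω + G (X' ω) := by
            simp_rw [smul_add, Finset.sum_add_distrib, ← Finset.sum_smul, hφ1 _ hω, one_smul]
            change _ = X' ω + (∑ i, φ i (X' ω) • z i + constVec N (2 * δ))
            abel
          rw [h2] at h1
          refine le_trans (Finset.sum_le_sum fun i _ => ?_) h1
          rcases eq_or_ne (φ i (X' ω)) 0 with h0 | h0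
          · simp [h0]
          · refine mul_le_mul_of_nonneg_left (hU.nondecreasing _ _ fun j => ?_) (hφ0 i _)
            have := (abs_le.1 (hp i _ h0 j)).1
            simp only [PiLp.add_apply, constVec_apply]
            linarith
  have hupper : ∫ ω, U (X ω + Y ω) ∂P ≤ ∑ i, q i * U (p i + constVec N δ + y i) := by
    have hi : ∀ i, Integrable (fun ω => φ i (X ω) * U (X ω + Y ω)) P := fun i =>
      ((hφX i).integrable le_top).smul_of_top_left
        ((hX.add hY).continuous_comp hU.continuous)
    calc ∫ ω, U (X ω + Y ω) ∂P = ∫ ω, ∑ i, φ i (X ω) * U (X ω + Y ω) ∂P := by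
          refine integral_congr_ae ?_
          filter_upwards [hrX] with ω hω
          rw [← Finset.sum_mul, hφ1 _ hω, one_mul]
      _ = ∑ i, ∫ ω, φ i (X ω) * U (X ω + Y ω) ∂P := integral_finsetSum _ fun i _ => hi i
      _ ≤ _ := Finset.sum_le_sum fun i _ => hyU i
  refine le_trans ?_ hlower
  rw [sub_le_iff_le_add, Finset.mul_sum, ← Finset.sum_add_distrib]
  refine hupper.trans (Finset.sum_le_sum fun i _ => ?_)
  have hconc : θ i * U (p i + constVec N δ + y i) + (1 - θ i) * U (p i + constVec N δ + y₀) ≤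
      u i := by
    have h := hU.concaveOn.2 (Set.mem_univ (p i + constVec N δ + y i))
      (Set.mem_univ (p i + constVec N δ + y₀)) (hθ0 i) (sub_nonneg.2 (hθ1 i)) (by ring)
    have e : θ i • (p i + constVec N δ + y i) + (1 - θ i) • (p i + constVec N δ + y₀) =
        p i + constVec N δ + z i := by
      rw [hz]; module
    rw [e] at h
    exact h
  have h1 := mul_le_mul_of_nonneg_left hconc (hq0' i)
  have h2 : q' i * (θ i * U (p i + constVec N δ + y i) +
      (1 - θ i) * U (p i + constVec N δ + y₀)) =
      min (q i) (q' i) * U (p i + constVec N δ + y i) +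
        (q' i - min (q i) (q' i)) * U (p i + constVec N δ + y₀) := by
    rw [← hqθ]; ring
  -- Mass of `X` in excess of `X'` loses at most `M` per unit, and mass of `X'` in excess of `X`
  -- costs at most `M` per unit; together this is `M * |q i - q' i|`.
  have h3 : (q i - min (q i) (q' i)) * U (p i + constVec N δ + y i) ≤
      (q i - min (q i) (q' i)) * M :=
    mul_le_mul_of_nonneg_left (hM i _ (hyc i)) (sub_nonneg.2 (min_le_left _ _))
  have h4 : (q' i - min (q i) (q' i)) * -M ≤
      (q' i - min (q i) (q' i)) * U (p i + constVec N δ + y₀) :=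
    mul_le_mul_of_nonneg_left (hM₀ i) (sub_nonneg.2 (min_le_right _ _))
  have h5 : |q i - q' i| = (q i - min (q i) (q' i)) + (q' i - min (q i) (q' i)) := by
    rcases le_total (q i) (q' i) with h | h
    · rw [min_eq_left h, abs_of_nonpos (by linarith)]; ring
    · rw [min_eq_right h, abs_of_nonneg (by linarith)]; ring
  have h6 : M * |∫ ω, φ i (X ω) ∂P - ∫ ω, φ i (X' ω) ∂P| =
      (q i - min (q i) (q' i)) * M + (q' i - min (q i) (q' i)) * M := by
    rw [show |∫ ω, φ i (X ω) ∂P - ∫ ω, φ i (X' ω) ∂P| = |q i - q' i| from rfl, h5]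
    ring
  rw [h6]
  linarith

end Transfer

/-! ### Partition of unity and the uniform estimate -/

/-- A finite partition of unity of a ball, made of functions with small support. -/
lemma exists_partition (N : ℕ) {r δ : ℝ} (hδ : 0 < δ) :
    ∃ (t : Finset (EuclideanSpace ℝ (Fin N)))
      (φ : t → EuclideanSpace ℝ (Fin N) →ᵇ ℝ),
      (∀ p ∈ t, ‖p‖ ≤ r) ∧ (∀ i x, 0 ≤ φ i x) ∧ (∀ x, ‖x‖ ≤ r → ∑ i, φ i x = 1) ∧
      ∀ i x, φ i x ≠ 0 → ∀ j, |x j - i.1 j| ≤ δ := by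
  obtain ⟨t, hts, htf, hcov⟩ :=
    (isCompact_closedBall (0 : EuclideanSpace ℝ (Fin N)) r).finite_cover_balls (half_pos hδ)
  lift t to Finset (EuclideanSpace ℝ (Fin N)) using htf
  set ψ : EuclideanSpace ℝ (Fin N) → EuclideanSpace ℝ (Fin N) → ℝ :=
    fun p x => max 0 (δ - dist x p) with hψ
  -- The floor `δ / 2` keeps the denominator positive everywhere. It is inactive on the ball, where
  -- some centre is within `δ / 2` and its tent function is at least `δ / 2`.
  set s : EuclideanSpace ℝ (Fin N) → ℝ := fun x => max (δ / 2) (∑ p : t, ψ p x) with hs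
  have hψ0 : ∀ p x, 0 ≤ ψ p x := fun p x => le_max_left _ _
  have hs0 : ∀ x, 0 < s x := fun x => (half_pos hδ).trans_le (le_max_left _ _)
  have hψc : ∀ p, Continuous (ψ p) := fun p => by fun_prop
  have hsc : Continuous s :=
    continuous_const.max (continuous_finsetSum _ fun p _ => hψc p)
  have hsingle : ∀ (q : t) x, ψ q x ≤ ∑ p : t, ψ p x := fun q x =>
    Finset.single_le_sum (f := fun p : t => ψ p x) (fun i _ => hψ0 i x) (Finset.mem_univ q)
  have hle : ∀ (p : t) x, ψ p x / s x ≤ 1 := fun p x => by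
    exact div_le_one_of_le₀ ((hsingle p x).trans (le_max_right _ _)) (hs0 x).le
  set g : t → EuclideanSpace ℝ (Fin N) →ᵇ ℝ := fun p =>
    BoundedContinuousFunction.ofNormedAddCommGroup (fun x => ψ p x / s x)
      ((hψc p).div hsc fun x => (hs0 x).ne') 1 fun x => by
        rw [Real.norm_of_nonneg (div_nonneg (hψ0 _ _) (hs0 x).le)]
        exact hle p x
  have hg : ∀ p x, g p x = ψ p x / s x := fun _ _ => rfl
  clear_value g
  refine ⟨t, g, fun p hp => by simpa using hts hp, fun p x => ?_, fun x hx => ?_,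
    fun p x hx j => ?_⟩
  · rw [hg]
    exact div_nonneg (hψ0 _ _) (hs0 x).le
  · simp_rw [hg]
    rw [← Finset.sum_div Finset.univ (fun p : t => ψ p x) (s x)]
    obtain ⟨p, hpt, hp⟩ : ∃ p ∈ t, dist x p < δ / 2 := by
      simpa using hcov (show x ∈ Metric.closedBall 0 r by simpa using hx)
    have h1 : δ / 2 ≤ ψ p x := le_trans (by linarith) (le_max_right _ _)
    have h2 : ψ p x ≤ ∑ p : t, ψ p x := hsingle ⟨p, hpt⟩ x
    have h3 : s x = ∑ p : t, ψ p x := max_eq_right (h1.trans h2)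
    rw [← h3, div_self (hs0 x).ne']
  · rw [hg] at hx
    have h1 : dist x p.1 < δ := by
      by_contra h
      exact hx (by rw [show ψ p.1 x = 0 from max_eq_left (sub_nonpos.2 (not_lt.1 h)), zero_div])
    have h2 := abs_apply_le_norm (x - p.1) j
    rw [← dist_eq_norm] at h2
    simpa using h2.trans h1.le

/-- `ρ` is uniformly upper semicontinuous with respect to finitely many test functions. -/
lemma exists_finset_rho_le_add {N : ℕ} {U : EuclideanSpace ℝ (Fin N) → ℝ} (hU : IsUtility U)
    (hN : 1 ≤ N) {r ε : ℝ} (hε : 0 < ε) :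
    ∃ (F : Finset (EuclideanSpace ℝ (Fin N) →ᵇ ℝ)) (κ : ℝ), 0 < κ ∧
      ∀ {Ω : Type*} [MeasurableSpace Ω] (P : Measure Ω) [IsProbabilityMeasure P]
        (X X' : Ω → EuclideanSpace ℝ (Fin N)), MemLp X ∞ P → MemLp X' ∞ P →
        (∀ᵐ ω ∂P, ‖X ω‖ ≤ r) → (∀ᵐ ω ∂P, ‖X' ω‖ ≤ r) →
        (∀ f ∈ F, |∫ ω, f (X ω) ∂P - ∫ ω, f (X' ω) ∂P| ≤ κ) →
        rho P U X' ≤ rho P U X + ε := by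
  classical
  obtain ⟨y₁, a, ha, hy₁⟩ := hU.exists_uniform_pos r
  obtain ⟨A, l, hl, hA⟩ := hU.exists_affine_bound hN
  have hN' : (0 : ℝ) < N := by exact_mod_cast hN
  set δ := ε / (4 * N) with hδ
  -- Error budget: the shift costs `N * (2 * δ) = ε / 2`, and mixing with weight `τ` costs at most
  -- `τ * (b - c₀) ≤ ε / 2`, where `c₀` bounds every admissible total from below.
  have hδ0 : 0 < δ := by positivity
  set b := total y₁ with hb
  set c₀ := -(A / l) - N * r with hc₀
  set τ := min 1 (ε / (2 * (|b - c₀| + 1))) with hτ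
  have hτ0 : 0 < τ := by positivity
  have hτ1 : τ ≤ 1 := min_le_left _ _
  have hτ2 : τ * (b - c₀) ≤ ε / 2 := by
    have h1 : τ * (|b - c₀| + 1) ≤ ε / 2 := by
      calc τ * (|b - c₀| + 1) ≤ ε / (2 * (|b - c₀| + 1)) * (|b - c₀| + 1) := by
            gcongr; exact min_le_right _ _
        _ = ε / 2 := by field_simp
    nlinarith [le_abs_self (b - c₀)]
  obtain ⟨t, φ, htr, hφ0, hφ1, hφs⟩ := exists_partition N (r := r) hδ0
  -- The first term bounds `U` above on slices of total `c ≤ b`; the second bounds it below at the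
  -- equal split `c / N`, using `c₀ ≤ c`. Then `κ` makes the total mismatch cost at most `τ * a`.
  set M := |A + l * (N * r + N * δ + b)| + |U (constVec N (-r + c₀ / N))| with hM
  have hM0 : 0 ≤ M := by positivity
  set κ := τ * a / ((M + 1) * (t.card + 1)) with hκ
  refine ⟨Finset.univ.image φ, κ, by positivity, ?_⟩
  intro Ω _ P _ X X' hX hX' hrX hrX' hF
  obtain ⟨ρ, hρ⟩ := exists_rho_eq_coe hU hN hX
  obtain ⟨ρ', hρ'⟩ := exists_rho_eq_coe hU hN hX'
  have key : ∀ (Y : Ω → EuclideanSpace ℝ (Fin N)) (c : ℝ), MemLp Y ∞ P →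
      (∀ᵐ ω ∂P, total (Y ω) = c) → 0 ≤ ∫ ω, U (X ω + Y ω) ∂P → ρ' ≤ c + ε := by
    intro Y c hY hc hYU
    have hρb : ρ' ≤ b := by
      have := rho_le_total (U := U) hrX' ha hy₁
      rw [hρ'] at this
      exact_mod_cast this
    -- The constant allocation `y₁` already settles the case `b ≤ c`, so `c` may be confined to
    -- `[c₀, b]`.
    rcases le_total b c with hbc | hcb
    · linarith
    have hc0 : c₀ ≤ c := le_of_admissible hU hl hA hX hrX hY hc hYU
    obtain ⟨Y', hY', hYc', hYU'⟩ := exists_transfer hU hN φ (fun i => i.1) hφ0 hφ1 hφs hX hX'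
      hrX hrX' hY hc (M := M) (y₀ := constVec N (c / N))
      (fun i y hy => by
        refine (hA _).trans (le_trans ?_ ((le_abs_self _).trans
          (le_add_of_nonneg_right (abs_nonneg _))))
        rw [total_add, total_add, total_constVec, hy]
        have := total_le_of_norm_le (htr i.1 i.2)
        gcongr)
      (by rw [total_constVec]; field_simp)
      (fun i => by
        have h1 : -M ≤ U (constVec N (-r + c₀ / N)) := by
          have := neg_abs_le (U (constVec N (-r + c₀ / N)))
          have := abs_nonneg (A + l * (N * r + N * δ + b))
          linarith
        refine h1.trans (hU.nondecreasing _ _ fun j => ?_)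
        have h2 := (abs_le.1 ((abs_apply_le_norm i.1 j).trans (htr i.1 i.2))).1
        have h3 : c₀ / N ≤ c / N := by gcongr
        simp only [PiLp.add_apply, constVec_apply]
        linarith)
    have hsum : M * ∑ i, |∫ ω, φ i (X ω) ∂P - ∫ ω, φ i (X' ω) ∂P| ≤ τ * a := by
      have h1 : ∑ i, |∫ ω, φ i (X ω) ∂P - ∫ ω, φ i (X' ω) ∂P| ≤ t.card * κ := by
        calc _ ≤ ∑ _i : t, κ := Finset.sum_le_sum fun i _ =>
              hF _ (Finset.mem_image_of_mem _ (Finset.mem_univ i))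
          _ = t.card * κ := by simp
      calc _ ≤ M * (t.card * κ) := by gcongr
        _ ≤ (M + 1) * ((t.card + 1) * κ) := by
            have : 0 ≤ κ := by positivity
            gcongr <;> linarith
        _ = τ * a := by rw [hκ]; field_simp
    -- By concavity the share `τ` of `y₁` contributes at least `τ * a`, which pays for the deficit
    -- of `Y'`.
    set Y₂ : Ω → EuclideanSpace ℝ (Fin N) := fun ω => (1 - τ) • Y' ω + τ • y₁ with hY₂
    have hY₂m : MemLp Y₂ ∞ P := (hY'.const_smul (1 - τ)).add (memLp_const _)
    have hY₂U : 0 ≤ ∫ ω, U (X' ω + Y₂ ω) ∂P := by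
      have hi1 : Integrable (fun ω => U (X' ω + Y' ω)) P :=
        integrable_continuous_comp (hX'.add hY') hU.continuous
      have h1 : ∫ ω, (1 - τ) * U (X' ω + Y' ω) + τ * a ∂P ≤ ∫ ω, U (X' ω + Y₂ ω) ∂P := by
        refine integral_mono_ae ((hi1.const_mul _).add (integrable_const _))
          (integrable_continuous_comp (hX'.add hY₂m) hU.continuous) ?_
        filter_upwards [hrX'] with ω hω
        have h := hU.concaveOn.2 (Set.mem_univ (X' ω + Y' ω)) (Set.mem_univ (X' ω + y₁))
          (sub_nonneg.2 hτ1) hτ0.le (by ring)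
        have e : (1 - τ) • (X' ω + Y' ω) + τ • (X' ω + y₁) = X' ω + Y₂ ω := by
          rw [hY₂]; module
        rw [e] at h
        refine le_trans ?_ h
        have := mul_le_mul_of_nonneg_left (hy₁ _ hω) hτ0.le
        simpa using this
      rw [integral_add (hi1.const_mul _) (integrable_const _), integral_const_mul,
        integral_const, probReal_univ, one_smul] at h1
      refine le_trans ?_ h1
      have h2 : -(τ * a) ≤ ∫ ω, U (X' ω + Y' ω) ∂P := by linarith
      have h3 := mul_le_mul_of_nonneg_left h2 (sub_nonneg.2 hτ1)
      have h4 : 0 ≤ τ * (τ * a) := by positivity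
      linarith
    have hle : rho P U X' ≤ (((1 - τ) * (c + N * (2 * δ)) + τ * b : ℝ) : EReal) := by
      refine rho_le hY₂m ?_ hY₂U
      filter_upwards [hYc'] with ω hω
      rw [hY₂, total_add, total_smul, total_smul, hω]
    rw [hρ'] at hle
    have hle' : ρ' ≤ (1 - τ) * (c + N * (2 * δ)) + τ * b := by exact_mod_cast hle
    have h1 : N * (2 * δ) = ε / 2 := by rw [hδ]; field_simp; ring
    rw [h1] at hle'
    have h2 : τ * (b - c) ≤ τ * (b - c₀) := by gcongr
    have h3 : 0 ≤ τ * (ε / 2) := by positivity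
    linarith
  have h : ((ρ' - ε : ℝ) : EReal) ≤ rho P U X := by
    refine le_sInf ?_
    rintro _ ⟨Y, c, hY, hc, hYU, rfl⟩
    have := key Y c hY hc hYU
    exact_mod_cast sub_le_iff_le_add.2 this
  rw [hρ] at h
  rw [hρ, hρ']
  have h' : ρ' - ε ≤ ρ := by exact_mod_cast h
  exact_mod_cast sub_le_iff_le_add.1 h'

/-! ### A uniform variable on an atomless space -/

section Atomless

variable {Ω : Type*} [MeasurableSpace Ω]

/-- Inclusion of measurable sets with strict increase of the measure. -/
def StrictSub (P : Measure Ω) (A B : {s : Set Ω // MeasurableSet s}) : Prop :=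
  A.1 ⊆ B.1 ∧ P A.1 < P B.1

lemma mem_maxChain_of_forall {P : Measure Ω} {A : {s : Set Ω // MeasurableSet s}}
    (hA : ∀ D ∈ maxChain (StrictSub P), StrictSub P A D ∨ StrictSub P D A) :
    A ∈ maxChain (StrictSub P) := by
  have hmax := maxChain_spec (r := StrictSub P)
  have := hmax.2 (hmax.1.insert fun D hD _ => hA D hD) (Set.subset_insert _ _)
  rw [this]
  exact Set.mem_insert _ _

/-- Distinct members of the chain have distinct measures, so the measure alone decides inclusion. -/
lemma subset_of_mem_maxChain {P : Measure Ω} {A B : {s : Set Ω // MeasurableSet s}}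
    (hA : A ∈ maxChain (StrictSub P)) (hB : B ∈ maxChain (StrictSub P))
    (h : P A.1 ≤ P B.1) : A.1 ⊆ B.1 := by
  by_cases hAB : A = B
  · rw [hAB]
  · rcases (maxChain_spec (r := StrictSub P)).1 hA hB hAB with h' | h'
    · exact h'.1
    · exact absurd h'.2 h.not_gt

/-- Were the supremum of the measures up to `t` not attained, the union along a maximizing sequence
would have that measure and be comparable with every member, hence belong to the chain by
maximality. -/
lemma exists_greatest_mem_maxChain {P : Measure Ω} (t : ℝ≥0∞) :
    ∃ L ∈ maxChain (StrictSub P), P L.1 ≤ t ∧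
      ∀ D ∈ maxChain (StrictSub P), P D.1 ≤ t → P D.1 ≤ P L.1 := by
  set S : Set ℝ≥0∞ := {m | ∃ C ∈ maxChain (StrictSub P), P C.1 ≤ t ∧ P C.1 = m} with hS
  have hSne : S.Nonempty := by
    by_contra hne
    have hgt : ∀ D ∈ maxChain (StrictSub P), t < P D.1 := fun D hD => by
      by_contra h
      exact hne ⟨_, D, hD, not_lt.1 h, rfl⟩
    have hmem : (⟨∅, MeasurableSet.empty⟩ : {s : Set Ω // MeasurableSet s}) ∈
        maxChain (StrictSub P) :=
      mem_maxChain_of_forall fun D hD =>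
        Or.inl ⟨Set.empty_subset _, by simpa using (zero_le (a := t)).trans_lt (hgt D hD)⟩
    exact absurd (hgt _ hmem) (by simp)
  obtain ⟨u, -, hu, huS⟩ := exists_seq_tendsto_sSup hSne (OrderTop.bddAbove S)
  choose C hC hCt hCu using huS
  have hle : sSup S ≤ t := sSup_le fun m ⟨D, _, h, e⟩ => e ▸ h
  suffices h : ∃ L ∈ maxChain (StrictSub P), P L.1 = sSup S by
    obtain ⟨L, hL, e⟩ := h
    exact ⟨L, hL, e ▸ hle, fun D hD h => e ▸ le_sSup ⟨D, hD, h, rfl⟩⟩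
  by_contra! hno
  have hdir : Directed (· ⊆ ·) fun n => (C n).1 := fun m n => by
    rcases le_total (P (C m).1) (P (C n).1) with h | h
    · exact ⟨n, subset_of_mem_maxChain (hC m) (hC n) h, subset_rfl⟩
    · exact ⟨m, subset_rfl, subset_of_mem_maxChain (hC n) (hC m) h⟩
  have hPU : P (⋃ n, (C n).1) = sSup S := by
    rw [hdir.measure_iUnion]
    refine le_antisymm (iSup_le fun n => le_sSup ⟨_, hC n, hCt n, rfl⟩)
      (le_of_tendsto' hu fun n => ?_)
    rw [← hCu]
    exact le_iSup (fun n => P (C n).1) n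
  refine hno ⟨⋃ n, (C n).1, MeasurableSet.iUnion fun n => (C n).2⟩ ?_ hPU
  refine mem_maxChain_of_forall fun D hD => ?_
  rcases lt_or_gt_of_ne (hno D hD) with h | h
  · obtain ⟨n, hn⟩ := ((tendsto_order.1 hu).1 _ h).exists
    rw [← hCu] at hn
    exact Or.inr ⟨(subset_of_mem_maxChain hD (hC n) hn.le).trans
      (Set.subset_iUnion (fun n => (C n).1) n), h.trans_eq hPU.symm⟩
  · refine Or.inl ⟨Set.iUnion_subset fun n => subset_of_mem_maxChain (hC n) hD ?_,
      hPU.trans_lt h⟩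
    exact (le_sSup ⟨_, hC n, hCt n, rfl⟩ : P (C n).1 ≤ sSup S).trans h.le

lemma exists_least_mem_maxChain {P : Measure Ω} [IsFiniteMeasure P] {t : ℝ≥0∞}
    (ht : t ≤ P Set.univ) :
    ∃ R ∈ maxChain (StrictSub P), t ≤ P R.1 ∧
      ∀ D ∈ maxChain (StrictSub P), t ≤ P D.1 → P R.1 ≤ P D.1 := by
  set S : Set ℝ≥0∞ := {m | ∃ C ∈ maxChain (StrictSub P), t ≤ P C.1 ∧ P C.1 = m} with hS
  have hSne : S.Nonempty := by
    by_contra hne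
    have hgt : ∀ D ∈ maxChain (StrictSub P), P D.1 < t := fun D hD => by
      by_contra h
      exact hne ⟨_, D, hD, not_lt.1 h, rfl⟩
    have hmem : (⟨Set.univ, MeasurableSet.univ⟩ : {s : Set Ω // MeasurableSet s}) ∈
        maxChain (StrictSub P) :=
      mem_maxChain_of_forall fun D hD =>
        Or.inr ⟨Set.subset_univ _, (hgt D hD).trans_le ht⟩
    exact absurd (hgt _ hmem) ht.not_gt
  obtain ⟨u, -, hu, huS⟩ := exists_seq_tendsto_sInf hSne (OrderBot.bddBelow S)
  choose C hC hCt hCu using huS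
  have hle : t ≤ sInf S := le_sInf fun m ⟨D, _, h, e⟩ => e ▸ h
  suffices h : ∃ L ∈ maxChain (StrictSub P), P L.1 = sInf S by
    obtain ⟨L, hL, e⟩ := h
    exact ⟨L, hL, e ▸ hle, fun D hD h => e ▸ sInf_le ⟨D, hD, h, rfl⟩⟩
  by_contra! hno
  have hdir : Directed (· ⊇ ·) fun n => (C n).1 := fun m n => by
    rcases le_total (P (C m).1) (P (C n).1) with h | h
    · exact ⟨m, subset_rfl, subset_of_mem_maxChain (hC m) (hC n) h⟩
    · exact ⟨n, subset_of_mem_maxChain (hC n) (hC m) h, subset_rfl⟩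
  have hPU : P (⋂ n, (C n).1) = sInf S := by
    rw [hdir.measure_iInter (fun n => (C n).2.nullMeasurableSet) ⟨0, measure_ne_top _ _⟩]
    refine le_antisymm (ge_of_tendsto' hu fun n => ?_)
      (le_iInf fun n => sInf_le ⟨_, hC n, hCt n, rfl⟩)
    rw [← hCu]
    exact iInf_le (fun n => P (C n).1) n
  refine hno ⟨⋂ n, (C n).1, MeasurableSet.iInter fun n => (C n).2⟩ ?_ hPU
  refine mem_maxChain_of_forall fun D hD => ?_
  rcases lt_or_gt_of_ne (hno D hD) with h | h
  · refine Or.inr ⟨Set.subset_iInter fun n => subset_of_mem_maxChain hD (hC n) ?_,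
      h.trans_eq hPU.symm⟩
    exact h.le.trans (sInf_le ⟨_, hC n, hCt n, rfl⟩)
  · obtain ⟨n, hn⟩ := ((tendsto_order.1 hu).2 _ h).exists
    rw [← hCu] at hn
    exact Or.inl ⟨(Set.iInter_subset (fun n => (C n).1) n).trans
      (subset_of_mem_maxChain (hC n) hD hn.le), hPU.trans_lt h⟩

/-- If `t` were skipped, the chain would have a gap between `L` and `R`. Atomlessness splits `R \
L`, and adding a piece to `L` gives a set comparable with every member, which maximality puts inside
the gap. -/
lemma IsAtomless.exists_mem_maxChain {P : Measure Ω} [IsFiniteMeasure P] (hP : IsAtomless P)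
    {t : ℝ≥0∞} (ht : t ≤ P Set.univ) : ∃ C ∈ maxChain (StrictSub P), P C.1 = t := by
  obtain ⟨L, hL, hLt, hLmax⟩ := exists_greatest_mem_maxChain (P := P) t
  obtain ⟨R, hR, hRt, hRmin⟩ := exists_least_mem_maxChain ht
  by_contra! hno
  have hLt' : P L.1 < t := lt_of_le_of_ne hLt (hno L hL)
  have hRt' : t < P R.1 := lt_of_le_of_ne hRt (hno R hR).symm
  have hLR := subset_of_mem_maxChain hL hR (hLt'.trans hRt').le
  have hdiff : P (R.1 \ L.1) = P R.1 - P L.1 :=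
    measure_sdiff hLR L.2.nullMeasurableSet (measure_ne_top _ _)
  obtain ⟨B, hB, hBm, hB0, hBlt⟩ := hP (R.1 \ L.1) (R.2.diff L.2)
    (by rw [hdiff]; exact tsub_pos_of_lt (hLt'.trans hRt'))
  have hPLB : P (L.1 ∪ B) = P L.1 + P B :=
    measure_union (Set.disjoint_of_subset_right hB Set.disjoint_sdiff_right) hBm
  have h1 : P L.1 < P (L.1 ∪ B) := by
    rw [hPLB]; exact ENNReal.lt_add_right (measure_ne_top _ _) hB0.ne'
  have h2 : P (L.1 ∪ B) < P R.1 := by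
    rw [hPLB]
    rw [hdiff] at hBlt
    have := ENNReal.add_lt_add_left (measure_ne_top P L.1) hBlt
    rwa [add_tsub_cancel_of_le (hLt'.trans hRt').le] at this
  have hmem : (⟨L.1 ∪ B, L.2.union hBm⟩ : {s : Set Ω // MeasurableSet s}) ∈
      maxChain (StrictSub P) := by
    refine mem_maxChain_of_forall fun D hD => ?_
    rcases lt_or_gt_of_ne (hno D hD) with h | h
    · have hDL := hLmax D hD h.le
      exact Or.inr ⟨(subset_of_mem_maxChain hD hL hDL).trans Set.subset_union_left,
        hDL.trans_lt h1⟩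
    · have hRD := hRmin D hD h.le
      refine Or.inl ⟨(Set.union_subset hLR (hB.trans Set.sdiff_subset)).trans
        (subset_of_mem_maxChain hR hD hRD), h2.trans_le hRD⟩
  rcases le_total (P (L.1 ∪ B)) t with h | h
  · exact (hLmax _ hmem h).not_gt h1
  · exact (hRmin _ hmem h).not_gt h2

/-- An atomless probability space carries a uniformly distributed random variable. -/
lemma IsAtomless.exists_map_eq_volume {P : Measure Ω} [IsProbabilityMeasure P]
    (hP : IsAtomless P) :
    ∃ T : Ω → unitInterval, Measurable T ∧ P.map T = volume := by
  have hex (t : unitInterval) :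
      ∃ C ∈ maxChain (StrictSub P), P C.1 = ENNReal.ofReal t :=
    hP.exists_mem_maxChain (by simpa using t.2.2)
  choose C hC hPC using hex
  have hmono : ∀ s t : unitInterval, s ≤ t → (C s).1 ⊆ (C t).1 := fun s t hst =>
    subset_of_mem_maxChain (hC s) (hC t) (by
      rw [hPC, hPC]; exact ENNReal.ofReal_le_ofReal hst)
  obtain ⟨S, hSc, hSd⟩ := TopologicalSpace.exists_countable_dense unitInterval
  -- Restricting to a countable dense `S` makes `{T < x}` a countable union of sets `C q` with `q <
  -- x`, whose measure is `x`. Points in no such `C q` get the infimum of the empty set, which is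
  -- `1`.
  set T : Ω → unitInterval := fun ω => sInf {q | q ∈ S ∧ ω ∈ (C q).1} with hT
  have hpre (x : unitInterval) : T ⁻¹' Set.Iio x = ⋃ q ∈ S ∩ Set.Iio x, (C q).1 := by
    ext ω
    simp only [hT, Set.mem_preimage, Set.mem_Iio, sInf_lt_iff, Set.mem_iUnion, Set.mem_inter_iff,
      Set.mem_ofPred_eq, exists_prop]
    exact ⟨fun ⟨q, ⟨h1, h2⟩, h3⟩ => ⟨q, ⟨h1, h3⟩, h2⟩, fun ⟨q, ⟨h1, h3⟩, h2⟩ => ⟨q, ⟨h1, h2⟩, h3⟩⟩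
  have hmeas : Measurable T := by
    refine measurable_of_Iio fun x => ?_
    rw [hpre]
    exact MeasurableSet.biUnion (hSc.mono Set.inter_subset_left) fun q _ => (C q).2
  have : IsProbabilityMeasure (P.map T) := Measure.isProbabilityMeasure_map hmeas.aemeasurable
  refine ⟨T, hmeas, Measure.ext_of_Ici _ _ fun x => ?_⟩
  rw [← Set.compl_Iio, prob_compl_eq_one_sub measurableSet_Iio,
    prob_compl_eq_one_sub measurableSet_Iio]
  congr 1
  rw [Measure.map_apply hmeas measurableSet_Iio, unitInterval.volume_Iio, hpre]
  refine le_antisymm ?_ (le_of_forall_lt fun b hb => ?_)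
  · rw [← hPC]
    exact measure_mono (Set.iUnion₂_subset fun q hq => hmono q x hq.2.le)
  · have hbtop : b ≠ ∞ := (hb.trans ENNReal.ofReal_lt_top).ne
    have hb1 : b.toReal < x := by
      rwa [← ENNReal.ofReal_toReal hbtop, ENNReal.ofReal_lt_ofReal_iff_of_nonneg (by simp)] at hb
    let b' : unitInterval := ⟨b.toReal, ENNReal.toReal_nonneg, hb1.le.trans x.2.2⟩
    obtain ⟨q, hqS, hq1, hq2⟩ := hSd.exists_between (show b' < x from hb1)
    have hq1' : b.toReal < (q : ℝ) := hq1
    calc b = ENNReal.ofReal b.toReal := (ENNReal.ofReal_toReal hbtop).symm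
      _ < ENNReal.ofReal q := (ENNReal.ofReal_lt_ofReal_iff_of_nonneg (by simp)).2 hq1'
      _ = P (C q).1 := (hPC q).symm
      _ ≤ _ := measure_mono (Set.subset_biUnion_of_mem (u := fun q => (C q).1)
        (show q ∈ S ∩ Set.Iio x from ⟨hqS, hq2⟩))

/-- Every law on a standard Borel space is realized on an atomless probability space. -/
lemma IsAtomless.exists_map_eq {P : Measure Ω} [IsProbabilityMeasure P] (hP : IsAtomless P)
    {E : Type*} [MeasurableSpace E] [StandardBorelSpace E] [Nonempty E]
    (Q : Measure E) [IsProbabilityMeasure Q] : ∃ Z : Ω → E, Measurable Z ∧ P.map Z = Q := by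
  obtain ⟨T, hT, hTv⟩ := hP.exists_map_eq_volume
  obtain ⟨f, hf, hfQ⟩ := Q.exists_measurable_map_eq
  exact ⟨f ∘ T, hf.comp hT, by rw [← Measure.map_map hf hT, hTv, hfQ]⟩

end Atomless

/-! ### Law invariance, continuity and empirical consistency -/

section Laws

variable {Ω : Type*} [MeasurableSpace Ω] {P : Measure Ω} [IsProbabilityMeasure P] {N : ℕ}
  {U : EuclideanSpace ℝ (Fin N) → ℝ}

lemma rho_eq_of_map_eq (hU : IsUtility U) (hN : 1 ≤ N) {X X' : Ω → EuclideanSpace ℝ (Fin N)}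
    (hX : MemLp X ∞ P) (hX' : MemLp X' ∞ P) (h : P.map X = P.map X') :
    rho P U X = rho P U X' := by
  obtain ⟨r₁, -, hrX⟩ := exists_ae_norm_le hX
  obtain ⟨r₂, -, hrX'⟩ := exists_ae_norm_le hX'
  replace hrX : ∀ᵐ ω ∂P, ‖X ω‖ ≤ max r₁ r₂ := hrX.mono fun ω h => h.trans (le_max_left _ _)
  replace hrX' : ∀ᵐ ω ∂P, ‖X' ω‖ ≤ max r₁ r₂ := hrX'.mono fun ω h => h.trans (le_max_right _ _)
  have hint (f : EuclideanSpace ℝ (Fin N) →ᵇ ℝ) : ∫ ω, f (X ω) ∂P = ∫ ω, f (X' ω) ∂P := by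
    rw [← integral_map hX.1.aemeasurable f.continuous.aestronglyMeasurable, h,
      integral_map hX'.1.aemeasurable f.continuous.aestronglyMeasurable]
  obtain ⟨a, ha⟩ := exists_rho_eq_coe hU hN hX
  obtain ⟨a', ha'⟩ := exists_rho_eq_coe hU hN hX'
  rw [ha, ha']
  refine congrArg _ (le_antisymm (le_of_forall_pos_le_add fun ε hε => ?_)
    (le_of_forall_pos_le_add fun ε hε => ?_))
  all_goals obtain ⟨F, κ, hκ, hF⟩ := exists_finset_rho_le_add (r := max r₁ r₂) hU hN hε
  · have := hF P X' X hX' hX hrX' hrX fun f _ => by simp [hint f, hκ.le]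
    rw [ha, ha'] at this
    exact_mod_cast this
  · have := hF P X X' hX hX' hrX hrX' fun f _ => by simp [hint f, hκ.le]
    rw [ha, ha'] at this
    exact_mod_cast this

lemma rhoLaw_map (hU : IsUtility U) (hN : 1 ≤ N) {Z : Ω → EuclideanSpace ℝ (Fin N)}
    (hZ : MemLp Z ∞ P) : rhoLaw P U (P.map Z) = rho P U Z := by
  refine le_antisymm (sInf_le ⟨Z, hZ, rfl, rfl⟩) (le_sInf ?_)
  rintro _ ⟨Z', hZ', h, rfl⟩
  exact (rho_eq_of_map_eq hU hN hZ' hZ h).ge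

/-- Along uniformly bounded random vectors, `ρ` converges as soon as the expectations of a
suitable countable family of bounded continuous functions converge. -/
lemma exists_countable_tendsto_rho (hU : IsUtility U) (hN : 1 ≤ N) (r : ℝ) :
    ∃ F : Set (EuclideanSpace ℝ (Fin N) →ᵇ ℝ), F.Countable ∧
      ∀ (Z : ℕ → Ω → EuclideanSpace ℝ (Fin N)) (X : Ω → EuclideanSpace ℝ (Fin N)),
        (∀ᶠ n in atTop, MemLp (Z n) ∞ P ∧ ∀ᵐ ω ∂P, ‖Z n ω‖ ≤ r) →
        MemLp X ∞ P → (∀ᵐ ω ∂P, ‖X ω‖ ≤ r) →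
        (∀ f ∈ F, Tendsto (fun n => ∫ ω, f (Z n ω) ∂P) atTop (𝓝 (∫ ω, f (X ω) ∂P))) →
        Tendsto (fun n => rho P U (Z n)) atTop (𝓝 (rho P U X)) := by
  -- Only the tolerances `1 / (k + 1)` are needed, so countably many test functions suffice; this
  -- lets the strong law hold for all of them off a single null set.
  choose F κ hκ hF using fun k : ℕ =>
    exists_finset_rho_le_add (r := r) hU hN (Nat.one_div_pos_of_nat (α := ℝ) (n := k))
  refine ⟨⋃ k, (F k : Set (EuclideanSpace ℝ (Fin N) →ᵇ ℝ)), Set.countable_iUnion fun k => (F k).countable_toSet, ?_⟩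
  intro Z X hZ hX hrX hlim
  obtain ⟨ρ, hρ⟩ := exists_rho_eq_coe hU hN hX
  have hZρ : ∀ n, MemLp (Z n) ∞ P → rho P U (Z n) = ((rho P U (Z n)).toReal : EReal) := by
    intro n hn
    obtain ⟨a, ha⟩ := exists_rho_eq_coe hU hN hn
    rw [ha, EReal.toReal_coe]
  have hreal : Tendsto (fun n => (rho P U (Z n)).toReal) atTop (𝓝 ρ) := by
    refine Metric.tendsto_nhds.2 fun ε hε => ?_
    obtain ⟨k, hk⟩ := exists_nat_one_div_lt hε
    have hev : ∀ᶠ n in atTop, ∀ f ∈ F k,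
        |∫ ω, f (Z n ω) ∂P - ∫ ω, f (X ω) ∂P| < κ k := by
      refine (Finset.eventually_all _).2 fun f hf => ?_
      exact Metric.tendsto_nhds.1 (hlim f (Set.mem_iUnion.2 ⟨k, hf⟩)) _ (hκ k)
    filter_upwards [hev, hZ] with n hn hZn
    have h1 := hF k P X (Z n) hX hZn.1 hrX hZn.2 fun f hf => by
      rw [abs_sub_comm]; exact (hn f hf).le
    have h2 := hF k P (Z n) X hZn.1 hX hZn.2 hrX fun f hf => (hn f hf).le
    rw [hρ, hZρ n hZn.1] at h1 h2
    have h1' : (rho P U (Z n)).toReal ≤ ρ + 1 / (k + 1) := by exact_mod_cast h1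
    have h2' : ρ ≤ (rho P U (Z n)).toReal + 1 / (k + 1) := by exact_mod_cast h2
    rw [Real.dist_eq, abs_lt]
    constructor <;> linarith
  rw [hρ]
  refine (EReal.tendsto_coe.2 hreal).congr' ?_
  filter_upwards [hZ] with n hn
  exact (hZρ n hn.1).symm

lemma IsAtomless.exists_memLp_map_eq (hP : IsAtomless P)
    (Q : Measure (EuclideanSpace ℝ (Fin N))) [IsProbabilityMeasure Q] {r : ℝ}
    (hQ : ∀ᵐ x ∂Q, ‖x‖ ≤ r) :
    ∃ Z : Ω → EuclideanSpace ℝ (Fin N), MemLp Z ∞ P ∧ (∀ᵐ ω ∂P, ‖Z ω‖ ≤ r) ∧ P.map Z = Q := by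
  obtain ⟨Z, hZ, hZQ⟩ := hP.exists_map_eq Q
  have hr : ∀ᵐ ω ∂P, ‖Z ω‖ ≤ r := by
    rw [← hZQ] at hQ
    exact ae_of_ae_map hZ.aemeasurable hQ
  exact ⟨Z, memLp_top_of_bound hZ.aestronglyMeasurable r hr, hr, hZQ⟩

lemma ae_norm_le_of_closedBall {Q : Measure (EuclideanSpace ℝ (Fin N))}
    [IsProbabilityMeasure Q] {r : ℝ} (hQ : Q (Metric.closedBall 0 r) = 1) :
    ∀ᵐ x ∂Q, ‖x‖ ≤ r := by
  have := (prob_compl_eq_zero_iff Metric.isClosed_closedBall.measurableSet).2 hQ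
  rw [ae_iff]
  convert this using 2
  ext x
  simp

lemma isProbabilityMeasure_empiricalMeasure (x : ℕ → EuclideanSpace ℝ (Fin N)) {n : ℕ}
    (hn : n ≠ 0) : IsProbabilityMeasure (empiricalMeasure x n) := by
  constructor
  simp only [empiricalMeasure, Measure.smul_apply, Measure.finsetSum_apply, measure_univ,
    Finset.sum_const, Finset.card_range, nsmul_eq_mul, mul_one, smul_eq_mul]
  exact ENNReal.inv_mul_cancel (by exact_mod_cast hn) (ENNReal.natCast_ne_top n)

lemma integral_empiricalMeasure (x : ℕ → EuclideanSpace ℝ (Fin N)) (n : ℕ)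
    (f : EuclideanSpace ℝ (Fin N) →ᵇ ℝ) :
    ∫ z, f z ∂(empiricalMeasure x n) = (n : ℝ)⁻¹ • ∑ i ∈ Finset.range n, f (x i) := by
  rw [empiricalMeasure, integral_smul_measure, integral_finsetSum_measure]
  · simp
  · exact fun i _ => f.integrable _

lemma ae_norm_le_empiricalMeasure {x : ℕ → EuclideanSpace ℝ (Fin N)} {r : ℝ}
    (hx : ∀ i, ‖x i‖ ≤ r) (n : ℕ) : ∀ᵐ z ∂(empiricalMeasure x n), ‖z‖ ≤ r := by
  rw [ae_iff, empiricalMeasure, Measure.smul_apply, Measure.finsetSum_apply]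
  simp [hx]

lemma tendsto_rhoLaw (hP : IsAtomless P) (hU : IsUtility U) (hN : 1 ≤ N)
    {Q : ℕ → ProbabilityMeasure (EuclideanSpace ℝ (Fin N))}
    {Q' : ProbabilityMeasure (EuclideanSpace ℝ (Fin N))} {r : ℝ}
    (hQ : ∀ n, (Q n : Measure (EuclideanSpace ℝ (Fin N))) (Metric.closedBall 0 r) = 1)
    (hQ' : (Q' : Measure (EuclideanSpace ℝ (Fin N))) (Metric.closedBall 0 r) = 1)
    (hlim : Tendsto Q atTop (𝓝 Q')) :
    Tendsto (fun n => rhoLaw P U (Q n : Measure (EuclideanSpace ℝ (Fin N)))) atTop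
      (𝓝 (rhoLaw P U (Q' : Measure (EuclideanSpace ℝ (Fin N))))) := by
  choose Z hZ hZr hZQ using fun n =>
    hP.exists_memLp_map_eq (Q n : Measure (EuclideanSpace ℝ (Fin N)))
      (ae_norm_le_of_closedBall (hQ n))
  obtain ⟨X, hX, hXr, hXQ⟩ := hP.exists_memLp_map_eq
    (Q' : Measure (EuclideanSpace ℝ (Fin N))) (ae_norm_le_of_closedBall hQ')
  obtain ⟨F, -, hF⟩ := exists_countable_tendsto_rho (P := P) hU hN r
  simp_rw [← hZQ, ← hXQ, rhoLaw_map hU hN (hZ _), rhoLaw_map hU hN hX]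
  refine hF Z X (Eventually.of_forall fun n => ⟨hZ n, hZr n⟩) hX hXr fun f _ => ?_
  have h := ProbabilityMeasure.tendsto_iff_forall_integral_tendsto.1 hlim f
  rw [← hXQ, integral_map hX.1.aemeasurable f.continuous.aestronglyMeasurable] at h
  refine h.congr fun n => ?_
  rw [← hZQ, integral_map (hZ n).1.aemeasurable f.continuous.aestronglyMeasurable]

/-- For a fixed good `ω`, the empirical measures are deterministic laws in a common ball. They are
realized by auxiliary vectors `Z n` on `Ω`, and the strong law says exactly that the test
expectations of `Z n` converge. -/
lemma ae_tendsto_rhoLaw_empiricalMeasure (hP : IsAtomless P) (hU : IsUtility U) (hN : 1 ≤ N)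
    {X : Ω → EuclideanSpace ℝ (Fin N)} {S : ℕ → Ω → EuclideanSpace ℝ (Fin N)}
    (hX : MemLp X ∞ P) (hind : iIndepFun S P) (hid : ∀ i, IdentDistrib (S i) X P P) :
    ∀ᵐ ω ∂P, Tendsto (fun n => rhoLaw P U (empiricalMeasure (fun i => S i ω) n)) atTop
      (𝓝 (rho P U X)) := by
  obtain ⟨r, -, hXr⟩ := exists_ae_norm_le hX
  obtain ⟨F, hFc, hF⟩ := exists_countable_tendsto_rho (P := P) hU hN r
  have hSr : ∀ᵐ ω ∂P, ∀ i, ‖S i ω‖ ≤ r := ae_all_iff.2 fun i =>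
    (hid i).symm.ae_snd (p := fun x => ‖x‖ ≤ r)
      (measurableSet_le measurable_norm measurable_const) hXr
  have hS : ∀ᵐ ω ∂P, ∀ f ∈ F, Tendsto
      (fun n : ℕ => (n : ℝ)⁻¹ • ∑ i ∈ Finset.range n, f (S i ω)) atTop
      (𝓝 (∫ ω, f (X ω) ∂P)) := by
    refine (ae_ball_iff hFc).2 fun f _ => ?_
    have hid' (i : ℕ) : IdentDistrib (fun ω => f (S i ω)) (fun ω => f (X ω)) P P :=
      (hid i).comp f.continuous.measurable
    have hint : Integrable (fun ω => f (S 0 ω)) P :=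
      (hid' 0).integrable_iff.2 (integrable_continuous_comp hX f.continuous)
    rw [← (hid' 0).integral_eq]
    exact strong_law_ae (fun i ω => f (S i ω)) hint
      (fun i j hij => (hind.indepFun hij).comp f.continuous.measurable f.continuous.measurable)
      fun i => (hid' i).trans (hid' 0).symm
  filter_upwards [hSr, hS] with ω hωr hωS
  -- At `n = 0` the empirical measure is zero and has no realization, so a dummy vector is used
  -- there.
  have hex (n : ℕ) : ∃ Z : Ω → EuclideanSpace ℝ (Fin N), n ≠ 0 →
      MemLp Z ∞ P ∧ (∀ᵐ ω ∂P, ‖Z ω‖ ≤ r) ∧ P.map Z = empiricalMeasure (fun i => S i ω) n := by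
    by_cases hn : n = 0
    · exact ⟨0, fun h => absurd hn h⟩
    · have := isProbabilityMeasure_empiricalMeasure (fun i => S i ω) hn
      obtain ⟨Z, hZ⟩ := hP.exists_memLp_map_eq (empiricalMeasure (fun i => S i ω) n)
        (ae_norm_le_empiricalMeasure hωr n)
      exact ⟨Z, fun _ => hZ⟩
  choose Z hZ using hex
  refine (hF Z X ?_ hX hXr fun f hf => ?_).congr' ?_
  · filter_upwards [eventually_ne_atTop 0] with n hn
    exact ⟨(hZ n hn).1, (hZ n hn).2.1⟩
  · refine (hωS f hf).congr' ?_
    filter_upwards [eventually_ne_atTop 0] with n hn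
    rw [← integral_empiricalMeasure (fun i => S i ω), ← (hZ n hn).2.2,
      integral_map (hZ n hn).1.1.aemeasurable f.continuous.aestronglyMeasurable]
  · filter_upwards [eventually_ne_atTop 0] with n hn
    rw [← (hZ n hn).2.2, rhoLaw_map hU hN (hZ n hn).1]

end Laws

end SystemicRisk

theorem mainTheorem6 {Ω : Type*} [MeasurableSpace Ω] (P : Measure Ω) [IsProbabilityMeasure P]
    (hP : SystemicRisk.IsAtomless P)
    (N : ℕ) (hN : 1 ≤ N) (U : EuclideanSpace ℝ (Fin N) → ℝ) (hU : SystemicRisk.IsUtility U) :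
    -- `ρ` is finite valued and law invariant, and `rhoLaw` is the induced function of laws
    (∀ Z : Ω → EuclideanSpace ℝ (Fin N), MemLp Z ∞ P →
      (∃ a : ℝ, SystemicRisk.rho P U Z = (a : EReal)) ∧
      SystemicRisk.rhoLaw P U (P.map Z) = SystemicRisk.rho P U Z) ∧
    -- every boundedly supported law is realized on `(Ω, P)`
    (∀ (Q : ProbabilityMeasure (EuclideanSpace ℝ (Fin N))) (r : ℝ), 0 < r →
      (Q : Measure (EuclideanSpace ℝ (Fin N))) (Metric.closedBall 0 r) = 1 →
      ∃ Z : Ω → EuclideanSpace ℝ (Fin N), MemLp Z ∞ P ∧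
        P.map Z = (Q : Measure (EuclideanSpace ℝ (Fin N)))) ∧
    -- continuity along weakly convergent, uniformly boundedly supported sequences of laws
    (∀ (Q : ℕ → ProbabilityMeasure (EuclideanSpace ℝ (Fin N)))
      (Qinf : ProbabilityMeasure (EuclideanSpace ℝ (Fin N))) (r : ℝ), 0 < r →
      (∀ n, (Q n : Measure (EuclideanSpace ℝ (Fin N))) (Metric.closedBall 0 r) = 1) →
      (Qinf : Measure (EuclideanSpace ℝ (Fin N))) (Metric.closedBall 0 r) = 1 →
      Tendsto Q atTop (𝓝 Qinf) →
      Tendsto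
        (fun n => SystemicRisk.rhoLaw P U (Q n : Measure (EuclideanSpace ℝ (Fin N)))) atTop
        (𝓝 (SystemicRisk.rhoLaw P U (Qinf : Measure (EuclideanSpace ℝ (Fin N)))))) ∧
    -- consistency of the empirical estimates
    (∀ (X : Ω → EuclideanSpace ℝ (Fin N)) (S : ℕ → Ω → EuclideanSpace ℝ (Fin N)),
      MemLp X ∞ P → iIndepFun S P → (∀ i, IdentDistrib (S i) X P P) →
      ∀ᵐ ω ∂P, Tendsto
        (fun n => SystemicRisk.rhoLaw P U (SystemicRisk.empiricalMeasure (fun i => S i ω) n))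
        atTop (𝓝 (SystemicRisk.rho P U X))) := by
  open SystemicRisk in
  refine ⟨fun Z hZ => ⟨exists_rho_eq_coe hU hN hZ, rhoLaw_map hU hN hZ⟩, fun Q r _ hQ => ?_,
    fun Q Q' r _ hQ hQ' hlim => tendsto_rhoLaw hP hU hN hQ hQ' hlim,
    fun X S hX hind hid => ae_tendsto_rhoLaw_empiricalMeasure hP hU hN hX hind hid⟩
  obtain ⟨Z, hZ, -, hZQ⟩ := hP.exists_memLp_map_eq (Q : Measure (EuclideanSpace ℝ (Fin N)))
    (SystemicRisk.ae_norm_le_of_closedBall hQ)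
  exact ⟨Z, hZ, hZQ⟩
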